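/- **Lemma 2.2.** Let $\mathbb{K}$ be an algebraically closed field of characteristic $0$ and let $\widetilde S$ be a generalized del Pezzo surface over $\mathbb{K}$, i.e., a non-singular projective surface whose anticanonical class is big and nef. For divisors $D_0,\dots,D_r$ on $\widetilde S$ whose classes form a basis of $\operatorname{Pic}(\widetilde S)$, let $$\operatorname{Cox}(\widetilde S)=\operatorname{Cox}(\widetilde S,D_0,\dots,D_r)=\bigoplus_{(\nu_0,\dots,\nu_r)\in\mathbb{Z}^{r+1}}H^0(\widetilde S,\mathcal{O}(\nu_0D_0+\dots+\nu_rD_r)),$$ with the multiplication induced by the multiplication of sections and with the natural $\operatorname{Pic}(\widetilde S)$-grading. A *minimal system of generators* is a finite family $\eta_1,\dots,\eta_t$ of homogeneous elements that generates $\operatorname{Cox}(\widetilde S)$ as a $\mathbb{K}$-algebra while no proper subfamily does. A corresponding *minimal system of relations* is a finite family $R_1,\dots,R_m\in\mathbb{K}[X_1,\dots,X_t]$ of polynomials, homogeneous with respect to the $\operatorname{Pic}(\widetilde S)$-grading with $\deg X_i=\deg\eta_i$, that generates the kernel of the $\mathbb{K}$-algebra homomorphism $\Psi:\mathbb{K}[X_1,\dots,X_t]\to\operatorname{Cox}(\widetilde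 S)$, $X_i\mapsto\eta_i$, as an ideal while no proper subfamily does. Then, for any minimal system of generators and any corresponding minimal system of relations, the numbers $t$ and $m$ and the families of degrees $\deg\eta_1,\dots,\deg\eta_t$ and $\deg R_1,\dots,\deg R_m$ in $\operatorname{Pic}(\widetilde S)$ (up to order, counted with multiplicity) depend only on $\widetilde S$; in particular they do not depend on the choice of $D_0,\dots,D_r$, of the generators, or of the relations. -/

import Mathlib

open CategoryTheory AlgebraicGeometry
open scoped DirectSum

universe u

namespace DelPezzo

noncomputable section

/-! ### Cartier divisors and the Picard group of an integral scheme -/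

/-- The image of `𝒪_{S,x}ˣ` in `K(S)ˣ`. -/
def localUnits (S : Scheme.{u}) [IsIntegral S] (x : S) : Subgroup (S.functionField)ˣ :=
  (Units.map (algebraMap (S.presheaf.stalk x) S.functionField).toMonoidHom).range

/-- The group `Γ(S, 𝒦ˣ / 𝒪ˣ)`, written multiplicatively: families of elements of the stalks
`K(S)ˣ / 𝒪_{S,x}ˣ` that locally come from one rational function. -/
def cartierSubgroup (S : Scheme.{u}) [IsIntegral S] :
    Subgroup (∀ x : S, (S.functionField)ˣ ⧸ localUnits S x) where
  carrier := {D | ∀ x : S, ∃ U : S.Opens, x ∈ U ∧ ∃ f : (S.functionField)ˣ,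
    ∀ y ∈ U, D y = QuotientGroup.mk f}
  one_mem' := fun _ => ⟨⊤, trivial, 1, fun _ _ => rfl⟩
  mul_mem' := by
    intro D D' hD hD' x
    obtain ⟨U, hxU, f, hf⟩ := hD x
    obtain ⟨V, hxV, g, hg⟩ := hD' x
    refine ⟨U ⊓ V, ⟨hxU, hxV⟩, f * g, fun y hy => ?_⟩
    rw [Pi.mul_apply, hf y hy.1, hg y hy.2, QuotientGroup.mk_mul]
  inv_mem' := by
    intro D hD x
    obtain ⟨U, hxU, f, hf⟩ := hD x
    refine ⟨U, hxU, f⁻¹, fun y hy => ?_⟩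
    rw [Pi.inv_apply, hf y hy, QuotientGroup.mk_inv]

/-- The additive group of (Cartier) divisors on an integral scheme. On a non-singular variety
these are the same as Weil divisors. -/
def Divisor (S : Scheme.{u}) [IsIntegral S] : Type u := Additive (cartierSubgroup S)

instance (S : Scheme.{u}) [IsIntegral S] : AddCommGroup (Divisor S) :=
  inferInstanceAs (AddCommGroup (Additive (cartierSubgroup S)))

/-- The class in `K(S)ˣ / 𝒪_{S,x}ˣ` of the local equations of `D` at `x`. -/
def localClass {S : Scheme.{u}} [IsIntegral S] (D : Divisor S) (x : S) :
    (S.functionField)ˣ ⧸ localUnits S x :=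
  (Additive.toMul (α := cartierSubgroup S) D).1 x

/-- `f` is a local equation of the divisor `D` at the point `x`. -/
def IsLocalEquation {S : Scheme.{u}} [IsIntegral S] (D : Divisor S) (x : S)
    (f : (S.functionField)ˣ) : Prop :=
  localClass D x = QuotientGroup.mk f

/-- The divisor of a non-zero rational function. -/
def principalDivisor (S : Scheme.{u}) [IsIntegral S] :
    Additive (S.functionField)ˣ →+ Divisor S :=
  MonoidHom.toAdditive
    { toFun := fun f => ⟨fun _ => QuotientGroup.mk f, fun _ => ⟨⊤, trivial, f, fun _ _ => rfl⟩⟩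
      map_one' := rfl
      map_mul' := fun _ _ => rfl }

/-- The group of divisors modulo linear equivalence, which is `Pic S` since `S` is integral. -/
def Pic (S : Scheme.{u}) [IsIntegral S] : Type u := Divisor S ⧸ (principalDivisor S).range

instance (S : Scheme.{u}) [IsIntegral S] : AddCommGroup (Pic S) :=
  QuotientAddGroup.Quotient.addCommGroup (principalDivisor S).range

/-- The class of a divisor in the Picard group. -/
def divClass {S : Scheme.{u}} [IsIntegral S] : Divisor S →+ Pic S :=
  QuotientAddGroup.mk' (principalDivisor S).range

/-! ### Global sections -/

/-- The function field of an integral `K`-scheme is a `K`-algebra. -/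
instance functionFieldAlgebra (K : Type u) [Field K] (S : Scheme.{u}) [IsIntegral S]
    [S.Over (Spec (.of K))] : Algebra K S.functionField :=
  ((S.presheaf.germ ⊤ (genericPoint S) trivial).hom.comp
    ((S ↘ Spec (.of K)).appTop.hom.comp (Scheme.ΓSpecIso (.of K)).inv.hom)).toAlgebra

/-- The local ring `𝒪_{S,x}`, as a subring of the function field. -/
def localRing (S : Scheme.{u}) [IsIntegral S] (x : S) : Subring S.functionField :=
  (algebraMap (S.presheaf.stalk x) S.functionField).range

lemma algebraMap_mem_localRing (K : Type u) [Field K] {S : Scheme.{u}} [IsIntegral S]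
    [S.Over (Spec (.of K))] (x : S) (c : K) : algebraMap K S.functionField c ∈ localRing S x :=
  haveI : Nonempty (⊤ : S.Opens) := ⟨⟨x, trivial⟩⟩
  ⟨S.presheaf.germ ⊤ x trivial
      ((S ↘ Spec (.of K)).appTop.hom ((Scheme.ΓSpecIso (.of K)).inv.hom c)),
    Scheme.algebraMap_germ_eq_germToFunctionField S (U := ⊤) (x := x) trivial _⟩

lemma exists_isLocalEquation {S : Scheme.{u}} [IsIntegral S] (D : Divisor S) (x : S) :
    ∃ f, IsLocalEquation D x f :=
  ⟨(localClass D x).out, (QuotientGroup.out_eq' _).symm⟩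

/-- `H⁰(S, 𝒪(D))`: the rational functions `s` that are zero or satisfy `div s + D ≥ 0`, that is,
`s * f ∈ 𝒪_{S,x}` for every local equation `f` of `D` at every point `x`. -/
def H0 (K : Type u) [Field K] {S : Scheme.{u}} [IsIntegral S] [S.Over (Spec (.of K))]
    (D : Divisor S) : Submodule K S.functionField where
  carrier := {s | ∀ (x : S) (f : (S.functionField)ˣ), IsLocalEquation D x f →
    s * (f : S.functionField) ∈ localRing S x}
  zero_mem' := by
    intro x f _
    rw [zero_mul]
    exact zero_mem _
  add_mem' := by
    intro s t hs ht x f hf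
    rw [add_mul]
    exact add_mem (hs x f hf) (ht x f hf)
  smul_mem' := by
    intro c s hs x f hf
    rw [Algebra.smul_def, mul_assoc]
    exact mul_mem (algebraMap_mem_localRing K x c) (hs x f hf)

lemma one_mem_H0 (K : Type u) [Field K] {S : Scheme.{u}} [IsIntegral S]
    [S.Over (Spec (.of K))] : (1 : S.functionField) ∈ H0 K (0 : Divisor S) := by
  intro x f hf
  obtain ⟨u, hu⟩ := (QuotientGroup.eq_one_iff f).1 (Eq.symm hf)
  rw [one_mul, ← hu]
  exact ⟨u.1, rfl⟩

lemma mul_mem_H0 (K : Type u) [Field K] {S : Scheme.{u}} [IsIntegral S]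
    [S.Over (Spec (.of K))] {D D' : Divisor S} {s t : S.functionField} (hs : s ∈ H0 K D)
    (ht : t ∈ H0 K D') : s * t ∈ H0 K (D + D') := by
  intro x f hf
  obtain ⟨g, hg⟩ := exists_isLocalEquation D x
  obtain ⟨h, hh⟩ := exists_isLocalEquation D' x
  have key : (QuotientGroup.mk (g * h) : (S.functionField)ˣ ⧸ localUnits S x)
      = QuotientGroup.mk f := by
    rw [QuotientGroup.mk_mul, ← hg, ← hh, ← hf]
    rfl
  obtain ⟨u, hu⟩ := QuotientGroup.eq.1 key
  have hfu : (f : S.functionField)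
      = g * h * algebraMap (S.presheaf.stalk x) S.functionField u.1 := by
    have h1 : f = g * h * Units.map
        (algebraMap (S.presheaf.stalk x) S.functionField).toMonoidHom u := by
      rw [hu]; group
    rw [h1]; rfl
  have h2 : s * t * (f : S.functionField)
      = (s * g) * (t * h) * algebraMap (S.presheaf.stalk x) S.functionField u.1 := by
    rw [hfu]; ring
  rw [h2]
  exact mul_mem (mul_mem (hs x g hg) (ht x h hh)) ⟨u.1, rfl⟩

/-! ### Generalized del Pezzo surfaces -/

attribute [local instance] MvPolynomial.gradedAlgebra

/-- The structure morphism of projective `n`-space over `K`. -/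
def projectiveSpaceHom (K : Type u) [Field K] (n : ℕ) :
    Proj (MvPolynomial.homogeneousSubmodule (Fin (n + 1)) K) ⟶ Spec (.of K) :=
  Proj.toSpecZero (MvPolynomial.homogeneousSubmodule (Fin (n + 1)) K) ≫
    Spec.map (CommRingCat.ofHom
      (algebraMap K (MvPolynomial.homogeneousSubmodule (Fin (n + 1)) K 0)))

/-- `S` is isomorphic over `K` to a closed subscheme of some projective space. -/
def IsProjective (K : Type u) [Field K] (S : Scheme.{u}) [S.Over (Spec (.of K))] : Prop :=
  ∃ (n : ℕ) (i : S ⟶ Proj (MvPolynomial.homogeneousSubmodule (Fin (n + 1)) K)),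
    IsClosedImmersion i ∧ i ≫ projectiveSpaceHom K n = S ↘ Spec (.of K)

/-- `D` is a canonical divisor of the non-singular surface `S`: there is a non-zero rational
2-form `ω` with divisor `D`, that is, if `f` is a local equation of `D` at `x`, then `f⁻¹ ω`
generates the `𝒪_{S,x}`-module of regular 2-forms at `x`. -/
def IsCanonical (K : Type u) [Field K] {S : Scheme.{u}} [IsIntegral S] [S.Over (Spec (.of K))]
    (D : Divisor S) : Prop :=
  ∃ ω : ⋀[S.functionField]^2 (Ω[S.functionField⁄K]), ω ≠ 0 ∧
    ∀ (x : S) (f : (S.functionField)ˣ), IsLocalEquation D x f →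
      Submodule.span (localRing S x)
        {η | ∃ a ∈ localRing S x, ∃ b ∈ localRing S x,
          η = exteriorPower.ιMulti S.functionField 2
            ![KaehlerDifferential.D K S.functionField a,
              KaehlerDifferential.D K S.functionField b]} =
      Submodule.span (localRing S x) {((f⁻¹ : (S.functionField)ˣ) : S.functionField) • ω}

/-- `E` is the pull-back of `D` along `i`: at every point `x`, some local equation of `D` at `i x`
is a fraction `a / b` of elements of the local ring with non-zero images `i^* a`, `i^* b` in the
local ring at `x`, and `i^* a / i^* b` is a local equation of `E` at `x`. -/
def IsPullback {C S : Scheme.{u}} [IsIntegral C] [IsIntegral S] (i : C ⟶ S) (D : Divisor S)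
    (E : Divisor C) : Prop :=
  ∀ x : C, ∃ (a b : S.presheaf.stalk (i x)) (f : (S.functionField)ˣ) (g : (C.functionField)ˣ),
    (i.stalkMap x).hom a ≠ 0 ∧ (i.stalkMap x).hom b ≠ 0 ∧
    IsLocalEquation D (i x) f ∧ IsLocalEquation E x g ∧
    (f : S.functionField) * algebraMap _ S.functionField b = algebraMap _ S.functionField a ∧
    (g : C.functionField) * algebraMap _ C.functionField ((i.stalkMap x).hom b) =
      algebraMap _ C.functionField ((i.stalkMap x).hom a)

/-- The degree of a divisor on a projective integral curve over an algebraically closed field: the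
sum over the closed points of the order of vanishing of a local equation. -/
def degree {C : Scheme.{u}} [IsIntegral C] [IsLocallyNoetherian C] (E : Divisor C) : ℤ :=
  ∑ᶠ x : C, Scheme.ord ((localClass E x).out : C.functionField) x

/-- `D` is nef: for every integral curve `C ⊆ S`, the intersection number `(D, C)` is
non-negative. This number is the degree on `C` of the restriction of any divisor that is linearly
equivalent to `D` and whose support does not contain `C`. -/
def IsNef {S : Scheme.{u}} [IsIntegral S] (D : Divisor S) : Prop :=
  ∀ (C : Scheme.{u}) [IsIntegral C] [IsLocallyNoetherian C] (i : C ⟶ S) [IsClosedImmersion i],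
    topologicalKrullDim C = 1 →
    ∀ (D' : Divisor S) (E : Divisor C), divClass D' = divClass D → IsPullback i D' E →
      0 ≤ degree E

/-- The divisor `D` on a projective surface is big: `h⁰(S, 𝒪(mD))` grows like `m²`. -/
def IsBig (K : Type u) [Field K] {S : Scheme.{u}} [IsIntegral S] [S.Over (Spec (.of K))]
    (D : Divisor S) : Prop :=
  ∃ c : ℝ, 0 < c ∧ ∀ᶠ m : ℕ in Filter.atTop,
    c * (m : ℝ) ^ 2 ≤ (Module.finrank K (H0 K (m • D)) : ℝ)

/-- A generalized del Pezzo surface over the algebraically closed field `K`: a non-singular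
projective surface whose anticanonical class is big and nef. -/
structure IsGeneralizedDelPezzo (K : Type u) [Field K] (S : Scheme.{u}) [IsIntegral S]
    [S.Over (Spec (.of K))] : Prop where
  projective : IsProjective K S
  nonsingular_surface : SmoothOfRelativeDimension 2 (S ↘ Spec (.of K))
  anticanonical : ∃ κ : Divisor S, IsCanonical K κ ∧ IsBig K (-κ) ∧ IsNef (-κ)

/-! ### Cox rings -/

/-- The classes of `D₀, …, D_r` form a basis of `Pic S`. -/
def IsPicBasis {S : Scheme.{u}} [IsIntegral S] {r : ℕ} (D : Fin (r + 1) → Divisor S) : Prop :=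
  LinearIndependent ℤ (fun i => divClass (D i)) ∧
    Submodule.span ℤ (Set.range fun i => divClass (D i)) = ⊤

/-- The divisor `ν₀ D₀ + ⋯ + ν_r D_r`. -/
def combination {S : Scheme.{u}} [IsIntegral S] {r : ℕ} (D : Fin (r + 1) → Divisor S)
    (ν : Fin (r + 1) → ℤ) : Divisor S :=
  ∑ i, ν i • D i

lemma combination_zero {S : Scheme.{u}} [IsIntegral S] {r : ℕ} (D : Fin (r + 1) → Divisor S) :
    combination D 0 = 0 := by
  simp [combination]

lemma combination_add {S : Scheme.{u}} [IsIntegral S] {r : ℕ} (D : Fin (r + 1) → Divisor S)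
    (μ ν : Fin (r + 1) → ℤ) : combination D (μ + ν) = combination D μ + combination D ν := by
  simp [combination, add_zsmul, Finset.sum_add_distrib]

/-- The homogeneous components `H⁰(S, 𝒪(ν₀ D₀ + ⋯ + ν_r D_r))` of the Cox ring. -/
abbrev coxPiece (K : Type u) [Field K] {S : Scheme.{u}} [IsIntegral S] [S.Over (Spec (.of K))]
    {r : ℕ} (D : Fin (r + 1) → Divisor S) (ν : Fin (r + 1) → ℤ) : Submodule K S.functionField :=
  H0 K (combination D ν)

/-- Multiplication of rational functions maps sections of `𝒪(D)` and `𝒪(D')` to sections of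
`𝒪(D + D')`. -/
instance coxPiece_gradedMonoid (K : Type u) [Field K] {S : Scheme.{u}} [IsIntegral S]
    [S.Over (Spec (.of K))] {r : ℕ} (D : Fin (r + 1) → Divisor S) :
    SetLike.GradedMonoid (coxPiece K D) where
  one_mem := by
    rw [coxPiece, combination_zero]
    exact one_mem_H0 K
  mul_mem := by
    intro μ ν s t hs ht
    rw [coxPiece, combination_add]
    exact mul_mem_H0 K hs ht

/-- The Cox ring `⨁_ν H⁰(S, 𝒪(ν₀ D₀ + ⋯ + ν_r D_r))`, an external direct sum whose multiplication
is induced by the multiplication of sections. -/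
abbrev Cox (K : Type u) [Field K] {S : Scheme.{u}} [IsIntegral S] [S.Over (Spec (.of K))]
    {r : ℕ} (D : Fin (r + 1) → Divisor S) : Type u :=
  ⨁ ν : Fin (r + 1) → ℤ, coxPiece K D ν

/-- `s` lies in the part of the Cox ring of degree `c ∈ Pic S`. -/
def IsHomogeneousOfDegree {K : Type u} [Field K] {S : Scheme.{u}} [IsIntegral S]
    [S.Over (Spec (.of K))] {r : ℕ} {D : Fin (r + 1) → Divisor S} (s : Cox K D) (c : Pic S) :
    Prop :=
  ∃ ν : Fin (r + 1) → ℤ, divClass (combination D ν) = c ∧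
    s ∈ LinearMap.range (DirectSum.lof K (Fin (r + 1) → ℤ) (fun ν => coxPiece K D ν) ν)

/-- `e₁, …, e_t` is a minimal system of generators of the Cox ring, with degrees `c₁, …, c_t`. -/
structure IsMinimalGenerators {K : Type u} [Field K] {S : Scheme.{u}} [IsIntegral S]
    [S.Over (Spec (.of K))] {r : ℕ} {D : Fin (r + 1) → Divisor S} {t : ℕ}
    (e : Fin t → Cox K D) (c : Fin t → Pic S) : Prop where
  homogeneous : ∀ i, IsHomogeneousOfDegree (e i) (c i)
  generate : Algebra.adjoin K (Set.range e) = ⊤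
  minimal : ∀ I : Set (Fin t), I ≠ Set.univ → Algebra.adjoin K (e '' I) ≠ ⊤

/-- `R₁, …, R_m ∈ K[X₁, …, X_t]` is a minimal system of relations between the generators
`e₁, …, e_t` of degrees `c₁, …, c_t`: a minimal homogeneous generating system, with degrees
`b₁, …, b_m`, of the kernel of `Ψ : K[X₁, …, X_t] → Cox`, `X_i ↦ e_i`, where `X_i` has degree
`c_i`. -/
structure IsMinimalRelations {K : Type u} [Field K] {S : Scheme.{u}} [IsIntegral S]
    [S.Over (Spec (.of K))] {r : ℕ} {D : Fin (r + 1) → Divisor S} {t m : ℕ}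
    (e : Fin t → Cox K D) (c : Fin t → Pic S) (R : Fin m → MvPolynomial (Fin t) K)
    (b : Fin m → Pic S) : Prop where
  homogeneous : ∀ j, MvPolynomial.IsWeightedHomogeneous c (R j) (b j)
  generate : Ideal.span (Set.range R) =
    RingHom.ker (MvPolynomial.aeval e : MvPolynomial (Fin t) K →ₐ[K] Cox K D)
  minimal : ∀ J : Set (Fin m), J ≠ Set.univ → Ideal.span (R '' J) ≠
    RingHom.ker (MvPolynomial.aeval e : MvPolynomial (Fin t) K →ₐ[K] Cox K D)

end

end DelPezzo

/-! The Cox ring is positively graded in a weak sense that needs no order on `Pic S`. On a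
projective integral scheme over an algebraically closed field regular functions are constant, so the
degree-zero part is `K`; and if `D` and `-D` both have non-zero sections, then `D` is principal.
Hence no non-trivial monomial in minimal generators has degree zero, and a graded Nakayama argument
applies: the number of minimal generators of an ideal in each degree is determined by the ideal
(`card_degree_le`, via transition matrices of constant terms).

Two minimal systems of ring generators are related by a surjective homogeneous substitution of
polynomial rings (`exists_surjective_substitution`). Counting for the ideal of all variables
compares the degrees of generators; counting for the ideal of relations compares the degrees of
relations.

To compare different bases of `Pic S`, an additive choice `E` of one divisor per class is fixed.
Multiplication by suitable rational functions maps every Cox ring to the function field, taking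
degree `g` bijectively onto `H0 K (E g)` (`coxEval`). Both systems of generators thus become systems
of sections of one family of spaces. -/

namespace DelPezzo

open MvPolynomial
open Finsupp (single weight weight_single)

/-! ### Graded Nakayama for homogeneous ideals in polynomial rings -/

section WeightedPolynomials

variable {K : Type*} [Field K] {G : Type*} [AddCommGroup G] {σ : Type*} {w : σ → G}

lemma weightedHomogeneousComponent_mul_right {r : MvPolynomial σ K} {h : G}
    (hr : IsWeightedHomogeneous w r h) (g : G) (a : MvPolynomial σ K) :
    weightedHomogeneousComponent w g (a * r) = weightedHomogeneousComponent w (g - h) a * r := by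
  classical
  let _ := weightedGradedAlgebra K w
  have key := DirectSum.coe_decompose_mul_add_of_right_mem (weightedHomogeneousSubmodule K w)
    (i := g - h) (a := a) hr
  rw [sub_add_cancel] at key
  have e (f : MvPolynomial σ K) (d : G) :
      (DirectSum.decompose (weightedHomogeneousSubmodule K w) f d : MvPolynomial σ K)
        = weightedHomogeneousComponent w d f :=
    weightedDecomposition.decompose'_apply K w f d
  rwa [e, e] at key

lemma exists_homogeneous_coefficients {ι : Type*} [Fintype ι] {R : ι → MvPolynomial σ K} {b : ι → G}
    (hR : ∀ i, IsWeightedHomogeneous w (R i) (b i)) {f : MvPolynomial σ K} {g : G}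
    (hf : IsWeightedHomogeneous w f g) (hmem : f ∈ Ideal.span (Set.range R)) :
    ∃ a : ι → MvPolynomial σ K, (∀ i, IsWeightedHomogeneous w (a i) (g - b i)) ∧
      ∑ i, a i * R i = f := by
  obtain ⟨a, ha⟩ := (Submodule.mem_span_range_iff_exists_fun _).1 hmem
  refine ⟨fun i => weightedHomogeneousComponent w (g - b i) (a i),
    fun i => weightedHomogeneousComponent_isWeightedHomogeneous _ _, ?_⟩
  rw [← weightedHomogeneousComponent_eq_self hf, ← ha, map_sum]
  exact Finset.sum_congr rfl fun i _ => by
    rw [smul_eq_mul, weightedHomogeneousComponent_mul_right (hR i)]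

/-- The hypothesis `hw`, that only the trivial monomial has weight zero, replaces positivity of the
grading, since `G` carries no order. -/
lemma eq_C_of_isWeightedHomogeneous_zero (hw : ∀ n : σ →₀ ℕ, weight w n = 0 → n = 0)
    {f : MvPolynomial σ K} (hf : IsWeightedHomogeneous w f 0) : f = C (constantCoeff f) :=
  hf.eq_monomial_of_unique_weight hw

lemma constantCoeff_eq_zero {f : MvPolynomial σ K} {g : G} (hf : IsWeightedHomogeneous w f g)
    (hg : g ≠ 0) : constantCoeff f = 0 :=
  hf.coeff_eq_zero 0 (by rw [map_zero]; exact hg.symm)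

/-- The coefficients of a homogeneous relation between minimal generators of an ideal have no
constant terms. -/
lemma constantCoeff_eq_zero_of_sum_eq_zero (hw : ∀ n : σ →₀ ℕ, weight w n = 0 → n = 0)
    {ι : Type*} [Fintype ι] {R : ι → MvPolynomial σ K} {b : ι → G}
    (hmin : ∀ i, R i ∉ Ideal.span (R '' {i}ᶜ)) {a : ι → MvPolynomial σ K} {g : G}
    (ha : ∀ i, IsWeightedHomogeneous w (a i) (g - b i)) (hsum : ∑ i, a i * R i = 0) (i : ι) :
    constantCoeff (a i) = 0 := by
  classical
  by_contra hne
  -- A non-zero constant term forces degree zero, so `a i` is a unit of `K` and the relation can be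
  -- solved for `R i`.
  have h0 : g - b i = 0 := by
    by_contra h
    exact hne (constantCoeff_eq_zero (ha i) h)
  have hC := eq_C_of_isWeightedHomogeneous_zero hw (h0 ▸ ha i)
  apply hmin i
  rw [← Finset.add_sum_erase _ _ (Finset.mem_univ i), hC] at hsum
  have hRi : R i = -C (constantCoeff (a i))⁻¹ * ∑ l ∈ Finset.univ.erase i, a l * R l := by
    rw [eq_neg_of_add_eq_zero_right hsum, neg_mul_neg, ← mul_assoc, ← C_mul,
      inv_mul_cancel₀ hne, C_1, one_mul]
  rw [hRi]
  refine Ideal.mul_mem_left _ _ (Ideal.sum_mem _ fun l hl => Ideal.mul_mem_left _ _ ?_)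
  exact Ideal.subset_span ⟨l, (Finset.mem_erase.1 hl).1, rfl⟩

/-- The number of elements of given degree in a minimal homogeneous generating system of an ideal
is at most the number of elements of this degree in any homogeneous generating system. -/
theorem card_degree_le (hw : ∀ n : σ →₀ ℕ, weight w n = 0 → n = 0)
    {ι κ : Type*} [Fintype ι] [Fintype κ] {R : ι → MvPolynomial σ K} {b : ι → G}
    {R' : κ → MvPolynomial σ K} {b' : κ → G}
    (hR : ∀ i, IsWeightedHomogeneous w (R i) (b i))
    (hR' : ∀ k, IsWeightedHomogeneous w (R' k) (b' k))
    (hmin : ∀ i, R i ∉ Ideal.span (R '' {i}ᶜ))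
    (hRR' : ∀ i, R i ∈ Ideal.span (Set.range R')) (hR'R : ∀ k, R' k ∈ Ideal.span (Set.range R))
    (d : G) : Nat.card {i // b i = d} ≤ Nat.card {k // b' k = d} := by
  classical
  choose p hp hpR using fun i => exists_homogeneous_coefficients hR' (hR i) (hRR' i)
  choose q hq hqR using fun k => exists_homogeneous_coefficients hR (hR' k) (hR'R k)
  -- Substituting each system into the other gives `R i = ∑ p i k * q k l * R l`. Thus `p * q - 1`
  -- consists of coefficients of homogeneous relations, whose constant terms vanish.
  have key (i l : ι) : ∑ k, constantCoeff (p i k) * constantCoeff (q k l)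
      = if i = l then 1 else 0 := by
    have h := constantCoeff_eq_zero_of_sum_eq_zero hw hmin (g := b i) (b := b)
      (a := fun l => ∑ k, p i k * q k l - if i = l then 1 else 0) ?_ ?_ l
    · rw [map_sub, map_sum, sub_eq_zero] at h
      simp only [map_mul] at h
      rw [h]; split_ifs <;> simp
    · intro l
      refine (IsWeightedHomogeneous.sum _ _ _ fun k _ => ?_).sub ?_
      · simpa using (hp i k).mul (hq k l)
      · split_ifs with hl
        · rw [hl, sub_self]; exact isWeightedHomogeneous_one K w
        · exact isWeightedHomogeneous_zero K w _
    · simp only [sub_mul, Finset.sum_sub_distrib, ite_mul, one_mul, zero_mul,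
        Finset.sum_ite_eq, Finset.mem_univ, if_true, Finset.sum_mul]
      rw [Finset.sum_comm, sub_eq_zero]
      simp only [mul_assoc, ← Finset.mul_sum, hqR]
      exact hpR i
  let A : Matrix {i // b i = d} {k // b' k = d} K := fun i k => constantCoeff (p i k)
  let B : Matrix {k // b' k = d} {i // b i = d} K := fun k i => constantCoeff (q k i)
  have hAB : A * B = 1 := by
    ext i l
    rw [Matrix.mul_apply, Matrix.one_apply, ← if_congr Subtype.ext_iff.symm rfl rfl, ← key]
    change ∑ k : {k // b' k = d}, constantCoeff (p i k) * constantCoeff (q k l) = _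
    rw [← Finset.sum_subtype (Finset.univ.filter fun k => b' k = d) (by simp)
      fun k => constantCoeff (p i k) * constantCoeff (q k l)]
    -- Constant terms of `p i k` vanish unless `b' k = b i`, so the matrix identity restricts to the
    -- blocks of degree `d`.
    refine Finset.sum_subset (Finset.filter_subset _ _) fun k _ hk => ?_
    rw [constantCoeff_eq_zero (hp i k), zero_mul]
    rw [i.2, sub_ne_zero]
    exact fun h => hk (Finset.mem_filter.2 ⟨Finset.mem_univ k, h.symm⟩)
  have h1 := Matrix.rank_mul_le_left A B
  rw [hAB, Matrix.rank_one] at h1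
  rw [Nat.card_eq_fintype_card, Nat.card_eq_fintype_card]
  exact h1.trans (Matrix.rank_le_card_width A)

end WeightedPolynomials

/-! ### Evaluation of weighted homogeneous polynomials in graded pieces -/

section GradedEvaluation

variable {K : Type*} [Field K] {G : Type*} [AddCommGroup G] {σ : Type*} {c : σ → G}

lemma aeval_mem_graded {B : Type*} [CommSemiring B] [Algebra K B] (V : G → Submodule K B)
    [SetLike.GradedMonoid V] {s : σ → B} (hs : ∀ i, s i ∈ V (c i)) {f : MvPolynomial σ K} {g : G}
    (hf : IsWeightedHomogeneous c f g) : aeval s f ∈ V g := by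
  have hmon (n : σ →₀ ℕ) : (n.prod fun i k => s i ^ k) ∈ V (weight c n) := by
    induction n using Finsupp.induction_linear with
    | zero => simpa using SetLike.one_mem_graded V
    | add n n' hn hn' =>
      rw [Finsupp.prod_add_index' (fun _ => pow_zero _) (fun _ => pow_add _), map_add]
      exact SetLike.mul_mem_graded hn hn'
    | single i k =>
      rw [Finsupp.prod_single_index (h := fun i k => s i ^ k) (pow_zero _), weight_single]
      exact SetLike.pow_mem_graded k (hs i)
  rw [f.as_sum, map_sum]
  refine sum_mem fun n hn => ?_
  rw [aeval_monomial, ← Algebra.smul_def, ← hf (mem_support_iff.1 hn)]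
  exact Submodule.smul_mem _ _ (hmon n)

/-- No direct sum decomposition of `B` is assumed: a projection to one degree suffices, which covers
both polynomial rings and Cox rings. -/
lemma projection_aeval {B : Type*} [CommSemiring B] [Algebra K B] (V : G → Submodule K B)
    [SetLike.GradedMonoid V] {s : σ → B} (hs : ∀ i, s i ∈ V (c i)) {g : G} {π : B →+ B}
    (hπ : ∀ x ∈ V g, π x = x) (hπ' : ∀ h, g ≠ h → ∀ x ∈ V h, π x = 0) (f : MvPolynomial σ K) :
    π (aeval s f) = aeval s (weightedHomogeneousComponent c g f) := by
  induction f using MvPolynomial.induction_on' with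
  | monomial n a =>
    have hn : IsWeightedHomogeneous c (monomial n a) (weight c n) :=
      isWeightedHomogeneous_monomial _ _ _ rfl
    have hmem := aeval_mem_graded V hs hn
    by_cases h : g = weight c n
    · subst h
      rw [hn.weightedHomogeneousComponent_same, hπ _ hmem]
    · rw [hn.weightedHomogeneousComponent_ne _ h, hπ' _ h _ hmem, map_zero]
  | add p q hp hq => rw [map_add, map_add, hp, hq, map_add, map_add]

lemma weightedHomogeneousComponent_aeval {κ : Type*} {c' : κ → G} {ψ : κ → MvPolynomial σ K}
    (hψ : ∀ k, IsWeightedHomogeneous c (ψ k) (c' k)) (g : G) (f : MvPolynomial κ K) :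
    weightedHomogeneousComponent c g (aeval ψ f) = aeval ψ (weightedHomogeneousComponent c' g f) :=
  have := WeightedHomogeneousSubmodule.gradedMonoid (R := K) (w := c)
  projection_aeval (weightedHomogeneousSubmodule K c) hψ
    (π := (weightedHomogeneousComponent c g).toAddMonoidHom)
    (fun _ hx => IsWeightedHomogeneous.weightedHomogeneousComponent_same hx)
    (fun _ hh _ hx => IsWeightedHomogeneous.weightedHomogeneousComponent_ne g hx hh) f

end GradedEvaluation

/-! ### Minimal generators and relations for a pointed family of section spaces -/

section MinimalSectionSystems

variable {K : Type*} [Field K] {G : Type*} [AddCommGroup G] {F : Type*} [Field F] [Algebra K F]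

/-- A family of spaces of sections, closed under multiplication, that consists of constants in
degree zero and does not have non-zero elements in opposite non-zero degrees. -/
structure IsPointedSystem (V : G → Submodule K F) : Prop extends SetLike.GradedMonoid V where
  exists_constant : ∀ x ∈ V 0, ∃ a : K, algebraMap K F a = x
  pointed : ∀ {g : G} {x y : F}, x ∈ V g → y ∈ V (-g) → x ≠ 0 → y ≠ 0 → g = 0

/-- The sections `s i` of degrees `c i` generate all spaces `V g` in the sense of graded algebras,
and none of them is redundant. -/
structure IsMinimalSectionSystem {σ : Type*} (V : G → Submodule K F) (s : σ → F) (c : σ → G) :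
    Prop where
  mem : ∀ i, s i ∈ V (c i)
  lift : ∀ {g : G}, ∀ v ∈ V g, ∃ f : MvPolynomial σ K, IsWeightedHomogeneous c f g ∧ aeval s f = v
  minimal : ∀ (i : σ) (f : MvPolynomial σ K), IsWeightedHomogeneous c f (c i) → i ∉ f.vars →
    aeval s f ≠ s i

/-- The polynomials `R j`, of degrees `b j`, minimally generate the ideal that is generated by the
homogeneous relations between the sections `s i` of degrees `c i`. -/
structure IsMinimalRelationSystem {σ ι : Type*} (s : σ → F) (c : σ → G) (R : ι → MvPolynomial σ K)
    (b : ι → G) : Prop where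
  homogeneous : ∀ j, IsWeightedHomogeneous c (R j) (b j)
  mem_span_iff : ∀ {f : MvPolynomial σ K} {g : G}, IsWeightedHomogeneous c f g →
    (f ∈ Ideal.span (Set.range R) ↔ aeval s f = 0)
  minimal : ∀ j, R j ∉ Ideal.span (R '' {j}ᶜ)

namespace IsMinimalSectionSystem

variable {σ κ : Type*} {V : G → Submodule K F} {s : σ → F} {c : σ → G} {s' : κ → F} {c' : κ → G}

lemma ne_zero (hs : IsMinimalSectionSystem V s c) (i : σ) : s i ≠ 0 := fun h =>
  hs.minimal i 0 (isWeightedHomogeneous_zero K c _) (by simp) (by rw [map_zero, h])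

/-- A section of degree zero is a constant, hence already the value of a polynomial without
variables. -/
lemma degree_ne_zero (hV : IsPointedSystem V) (hs : IsMinimalSectionSystem V s c) (i : σ) :
    c i ≠ 0 := by
  intro h
  obtain ⟨a, ha⟩ := hV.exists_constant (s i) (h ▸ hs.mem i)
  refine hs.minimal i (C a) ?_ (by simp) (by rw [algHom_C, ha])
  rw [h]
  exact isWeightedHomogeneous_C c a

/-- If `X i` divides a monomial of weight zero, the cofactor has weight `-c i`. Both have non-zero
values because `F` is a field, so pointedness gives `c i = 0`, a contradiction. -/
lemma eq_zero_of_weight_eq_zero (hV : IsPointedSystem V) (hs : IsMinimalSectionSystem V s c)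
    (n : σ →₀ ℕ) (hn : weight c n = 0) : n = 0 := by
  have := hV.toGradedMonoid
  by_contra hne
  obtain ⟨i, hi⟩ := Finsupp.ne_iff.1 hne
  obtain ⟨n', rfl⟩ : ∃ n', n = single i 1 + n' :=
    exists_add_of_le (Finsupp.single_le_iff.2 (Nat.one_le_iff_ne_zero.2 hi))
  rw [map_add, weight_single, one_smul] at hn
  have hmem : aeval s (monomial n' (1 : K)) ∈ V (-c i) := aeval_mem_graded V hs.mem
    (isWeightedHomogeneous_monomial c n' 1 (eq_neg_of_add_eq_zero_right hn))
  refine hs.degree_ne_zero hV i (hV.pointed (hs.mem i) hmem (hs.ne_zero i) ?_)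
  rw [aeval_monomial, map_one, one_mul]
  exact Finset.prod_ne_zero_iff.2 fun k _ => pow_ne_zero _ (hs.ne_zero k)

/-- A homogeneous relation between minimal generators has no linear terms. -/
lemma coeff_single_eq_zero (hV : IsPointedSystem V) (hs : IsMinimalSectionSystem V s c)
    {f : MvPolynomial σ K} {g : G} (hf : IsWeightedHomogeneous c f g) (h0 : aeval s f = 0) (j : σ) :
    coeff (single j 1) f = 0 := by
  classical
  by_contra hne
  have hg : g = c j := by rw [← hf hne, weight_single, one_smul]
  subst hg
  -- The relation is solved for `X j`. Any other monomial of degree `c j` divisible by `X j` would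
  -- have a non-trivial cofactor of weight zero, so `X j` disappears entirely.
  refine hs.minimal j (X j - C (coeff (single j 1) f)⁻¹ * f)
    ((isWeightedHomogeneous_X K c j).sub (hf.C_mul _)) ?_ (by simp [h0])
  rw [mem_vars_iff_mem_support]
  rintro ⟨n, hn, hj⟩
  rw [mem_support_iff] at hn
  have hw := ((isWeightedHomogeneous_X K c j).sub (hf.C_mul (coeff (single j 1) f)⁻¹)) hn
  obtain ⟨n', rfl⟩ : ∃ n', n = single j 1 + n' :=
    exists_add_of_le (Finsupp.single_le_iff.2
      (Nat.one_le_iff_ne_zero.2 (Finsupp.mem_support_iff.1 hj)))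
  rw [map_add, weight_single, one_smul, add_eq_left] at hw
  rw [hs.eq_zero_of_weight_eq_zero hV n' hw, add_zero, coeff_sub, coeff_C_mul,
    inv_mul_cancel₀ hne, coeff_X] at hn
  simp at hn

/-- Homogeneous lifts of minimal generators generate the polynomial ring. -/
lemma eq_top_of_exists_lift [Finite σ] (hV : IsPointedSystem V) (hs : IsMinimalSectionSystem V s c)
    (A : Subalgebra K (MvPolynomial σ K))
    (hA : ∀ i, ∃ y ∈ A, IsWeightedHomogeneous c y (c i) ∧ aeval s y = s i) : A = ⊤ := by
  -- `r k i` says that `X k` times a non-trivial monomial has the degree of `X i`. Absence of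
  -- non-trivial monomials of weight zero makes this a strict order, well-founded because `σ` is
  -- finite.
  let r : σ → σ → Prop := fun k i => ∃ n : σ →₀ ℕ, n ≠ 0 ∧ weight c n + c k = c i
  have : IsTrans σ r := ⟨fun k i j ⟨n, hn, h⟩ ⟨n', _, h'⟩ =>
    ⟨n' + n, fun h0 => hn (add_eq_zero.1 h0).2, by rw [map_add, add_assoc, h, h']⟩⟩
  have : Std.Irrefl r := ⟨fun i ⟨n, hn, h⟩ =>
    hn (hs.eq_zero_of_weight_eq_zero hV n (add_eq_right.1 h))⟩
  have hwf : WellFounded r := Finite.wellFounded_of_trans_of_irrefl r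
  have hX (i : σ) : (X i : MvPolynomial σ K) ∈ A := by
    induction i using hwf.induction with
    | _ i ih =>
    obtain ⟨y, hyA, hy, hyi⟩ := hA i
    -- The difference `X i - y` is a homogeneous relation, so it has no linear terms and involves
    -- only variables below `i`.
    rw [← sub_add_cancel (X i : MvPolynomial σ K) y]
    refine add_mem ?_ hyA
    have hf := (isWeightedHomogeneous_X K c i).sub hy
    have h0 : aeval s (X i - y) = 0 := by rw [map_sub, aeval_X, hyi, sub_self]
    rw [as_sum (X i - y)]
    refine sum_mem fun n hn => ?_
    rw [monomial_eq]
    refine mul_mem (A.algebraMap_mem _) (prod_mem fun k hk => pow_mem (ih k ?_) _)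
    obtain ⟨n', rfl⟩ : ∃ n', n = single k 1 + n' :=
      exists_add_of_le (Finsupp.single_le_iff.2
        (Nat.one_le_iff_ne_zero.2 (Finsupp.mem_support_iff.1 hk)))
    refine ⟨n', ?_, ?_⟩
    · rintro rfl
      rw [add_zero, mem_support_iff] at hn
      exact hn (hs.coeff_single_eq_zero hV hf h0 k)
    · rw [← hf (mem_support_iff.1 hn), map_add, weight_single, one_smul, add_comm]
  rw [eq_top_iff, ← adjoin_range_X, Algebra.adjoin_le_iff]
  rintro _ ⟨i, rfl⟩
  exact hX i

/-- Two minimal systems of sections are related by a surjective homogeneous substitution. -/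
lemma exists_surjective_substitution [Finite σ] (hV : IsPointedSystem V)
    (hs : IsMinimalSectionSystem V s c) (hs' : IsMinimalSectionSystem V s' c') :
    ∃ ψ : κ → MvPolynomial σ K, (∀ k, IsWeightedHomogeneous c (ψ k) (c' k)) ∧
      (∀ f : MvPolynomial κ K, aeval s (aeval ψ f) = aeval s' f) ∧
      Function.Surjective (aeval ψ : MvPolynomial κ K →ₐ[K] MvPolynomial σ K) := by
  have := WeightedHomogeneousSubmodule.gradedMonoid (R := K) (w := c)
  choose ψ hψ hψs using fun k => hs.lift (s' k) (hs'.mem k)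
  choose φ hφ hφs using fun i => hs'.lift (s i) (hs.mem i)
  have hcomp (f : MvPolynomial κ K) : aeval s (aeval ψ f) = aeval s' f := by
    have : (aeval s).comp (aeval ψ) = (aeval s' : MvPolynomial κ K →ₐ[K] F) := by
      ext k; simp [hψs]
    exact DFunLike.congr_fun this f
  refine ⟨ψ, hψ, hcomp, ?_⟩
  rw [← AlgHom.range_eq_top]
  -- `aeval ψ (φ i)` need not equal `X i`, but it is a homogeneous lift of `s i`.
  exact hs.eq_top_of_exists_lift hV _ fun i => ⟨aeval ψ (φ i), ⟨φ i, rfl⟩,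
    aeval_mem_graded (weightedHomogeneousSubmodule K c) hψ (hφ i), by rw [hcomp, hφs]⟩

/-- The count is applied to the ideal of all variables, minimally generated by the `X i` and also
generated by the `ψ k`. -/
theorem card_degree_le [Fintype σ] [Fintype κ] (hV : IsPointedSystem V)
    (hs : IsMinimalSectionSystem V s c) (hs' : IsMinimalSectionSystem V s' c') (d : G) :
    Nat.card {i // c i = d} ≤ Nat.card {k // c' k = d} := by
  classical
  obtain ⟨ψ, hψ, -, hsurj⟩ := hs.exists_surjective_substitution hV hs'
  refine DelPezzo.card_degree_le (R := (X : σ → MvPolynomial σ K)) (R' := ψ)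
    (hs.eq_zero_of_weight_eq_zero hV) (isWeightedHomogeneous_X K c) hψ ?_ ?_ ?_ d
  · intro i hi
    rw [mem_ideal_span_X_image] at hi
    obtain ⟨l, hl, hli⟩ := hi (single i 1) (by simp)
    exact hli (Finsupp.single_eq_of_ne hl)
  all_goals have hψ0 (k : κ) : constantCoeff (ψ k) = 0 :=
    constantCoeff_eq_zero (hψ k) (hs'.degree_ne_zero hV k)
  · intro i
    obtain ⟨y, hy⟩ := hsurj (X i)
    have hmem : y - C (constantCoeff y) ∈ Ideal.span (Set.range (X : κ → MvPolynomial κ K)) := by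
      rw [← Set.image_univ, mem_ideal_span_X_image]
      intro n hn
      by_contra! h
      have : n = 0 := Finsupp.ext fun k => h k (Set.mem_univ k)
      rw [mem_support_iff, this, coeff_sub, coeff_zero_C] at hn
      exact hn (sub_self _)
    have hmap := Ideal.mem_map_of_mem (aeval ψ : MvPolynomial κ K →ₐ[K] MvPolynomial σ K) hmem
    have hrange : ψ = fun k => aeval ψ (X k : MvPolynomial κ K) :=
      funext fun k => (aeval_X ψ k).symm
    have heval : aeval ψ (y - C (constantCoeff y)) = X i - C (constantCoeff y) := by
      rw [map_sub, hy, aeval_C, algebraMap_eq]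
    rw [Ideal.map_span, ← Set.range_comp, heval] at hmap
    change _ ∈ Ideal.span (Set.range fun k => aeval ψ (X k : MvPolynomial κ K)) at hmap
    rw [← hrange] at hmap
    -- All `ψ k` and `X i` have zero constant term, so comparing constant terms kills that of `y`.
    have hconst : constantCoeff y = 0 := by
      have hle : Ideal.span (Set.range ψ) ≤ RingHom.ker (constantCoeff (σ := σ) (R := K)) :=
        Ideal.span_le.2 (by rintro _ ⟨k, rfl⟩; exact hψ0 k)
      have := hle hmap
      rw [RingHom.mem_ker, map_sub, constantCoeff_X, constantCoeff_C, zero_sub,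
        neg_eq_zero] at this
      exact this
    rwa [hconst, map_zero, sub_zero] at hmap
  · intro k
    rw [← Set.image_univ, mem_ideal_span_X_image]
    intro n hn
    by_contra! h
    have : n = 0 := Finsupp.ext fun i => h i (Set.mem_univ i)
    rw [mem_support_iff, this] at hn
    exact hn (hψ0 k)

/-- The substitution turns `R'` into a homogeneous generating system of the ideal generated by `R`;
surjectivity is what makes every `R i` attainable. -/
theorem card_relation_degree_le [Fintype σ] {ι ι' : Type*} [Fintype ι] [Fintype ι']
    (hV : IsPointedSystem V) (hs : IsMinimalSectionSystem V s c)
    (hs' : IsMinimalSectionSystem V s' c') {R : ι → MvPolynomial σ K} {b : ι → G}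
    {R' : ι' → MvPolynomial κ K} {b' : ι' → G} (hR : IsMinimalRelationSystem s c R b)
    (hR' : IsMinimalRelationSystem s' c' R' b') (d : G) :
    Nat.card {i // b i = d} ≤ Nat.card {k // b' k = d} := by
  have := WeightedHomogeneousSubmodule.gradedMonoid (R := K) (w := c)
  obtain ⟨ψ, hψ, hcomp, hsurj⟩ := hs.exists_surjective_substitution hV hs'
  have hψR (k : ι') : IsWeightedHomogeneous c (aeval ψ (R' k)) (b' k) :=
    aeval_mem_graded (weightedHomogeneousSubmodule K c) hψ (hR'.homogeneous k)
  refine DelPezzo.card_degree_le (R := R) (R' := fun k => aeval ψ (R' k))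
    (hs.eq_zero_of_weight_eq_zero hV) hR.homogeneous hψR hR.minimal ?_ ?_ d
  · intro i
    obtain ⟨y, hy⟩ := hsurj (R i)
    have hy' : aeval ψ (weightedHomogeneousComponent c' (b i) y) = R i := by
      rw [← weightedHomogeneousComponent_aeval hψ, hy,
        (hR.homogeneous i).weightedHomogeneousComponent_same]
    have hmem : weightedHomogeneousComponent c' (b i) y ∈ Ideal.span (Set.range R') := by
      rw [hR'.mem_span_iff (weightedHomogeneousComponent_isWeightedHomogeneous _ _), ← hcomp, hy',
        ← hR.mem_span_iff (hR.homogeneous i)]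
      exact Ideal.subset_span ⟨i, rfl⟩
    have hmap := Ideal.mem_map_of_mem (aeval ψ : MvPolynomial κ K →ₐ[K] MvPolynomial σ K) hmem
    rwa [Ideal.map_span, ← Set.range_comp, hy'] at hmap
  · intro k
    rw [hR.mem_span_iff (hψR k), hcomp, ← hR'.mem_span_iff (hR'.homogeneous k)]
    exact Ideal.subset_span ⟨k, rfl⟩

end IsMinimalSectionSystem

end MinimalSectionSystems

lemma count_map_univ {G ι : Type*} [DecidableEq G] [Fintype ι] (b : ι → G) (d : G) :
    Multiset.count d (Finset.univ.val.map b) = Nat.card {i // b i = d} := by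
  rw [Multiset.count_map, Nat.card_eq_fintype_card, Fintype.card_subtype]
  simp only [eq_comm]
  rfl

lemma map_univ_eq_of_card_eq {G ι κ : Type*} [Fintype ι] [Fintype κ] {b : ι → G} {b' : κ → G}
    (h : ∀ d, Nat.card {i // b i = d} = Nat.card {k // b' k = d}) :
    Finset.univ.val.map b = Finset.univ.val.map b' := by
  classical
  ext d
  rw [count_map_univ, count_map_univ, h]

end DelPezzo

namespace DelPezzo

/-! ### Regular functions on projective integral schemes -/

section ConstantFunctions

/-- A rational function that is regular at every point is a global section. -/
lemma exists_germ_eq_of_forall_mem_localRing {S : Scheme.{u}} [IsIntegral S] (s : S.functionField)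
    (hs : ∀ x : S, s ∈ localRing S x) :
    ∃ g : Γ(S, ⊤), S.presheaf.germ ⊤ (genericPoint S) trivial g = s := by
  have hloc (x : S) : ∃ (U : S.Opens) (hx : x ∈ U) (t : Γ(S, U)),
      S.presheaf.germ U (genericPoint S)
        ((genericPoint_specializes x).mem_open U.isOpen hx) t = s := by
    obtain ⟨a, ha⟩ := hs x
    obtain ⟨U, hx, t, rfl⟩ := S.presheaf.exists_germ_eq a
    have : Nonempty U := ⟨⟨x, hx⟩⟩
    exact ⟨U, hx, t, (Scheme.algebraMap_germ_eq_germToFunctionField S hx t).symm.trans ha⟩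
  choose U hU t ht using hloc
  obtain ⟨g, hg, -⟩ := S.sheaf.existsUnique_gluing' U ⊤ (fun x => homOfLE le_top)
    (fun x _ => TopologicalSpace.Opens.mem_iSup.2 ⟨x, hU x⟩) t (by
      intro x y
      have hmem : genericPoint S ∈ U x ⊓ U y :=
        ⟨(genericPoint_specializes x).mem_open (U x).isOpen (hU x),
          (genericPoint_specializes y).mem_open (U y).isOpen (hU y)⟩
      apply germ_injective_of_isIntegral S (genericPoint S) hmem
      exact (S.presheaf.germ_res_apply _ _ hmem _).trans
        ((ht x).trans ((ht y).symm.trans (S.presheaf.germ_res_apply _ _ hmem _).symm)))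
  obtain ⟨x⟩ : Nonempty S := inferInstance
  refine ⟨g, ?_⟩
  rw [← ht x, ← hg x]
  exact (S.presheaf.germ_res_apply (homOfLE le_top) _ _ g).symm

attribute [local instance] MvPolynomial.gradedAlgebra

instance projectiveSpaceHom_isProper (K : Type u) [Field K] (n : ℕ) :
    IsProper (projectiveSpaceHom K n) := by
  let 𝒜 := MvPolynomial.homogeneousSubmodule (Fin (n + 1)) K
  have : Algebra.FiniteType (𝒜 0) (MvPolynomial (Fin (n + 1)) K) := by
    rw [← RingHom.finiteType_algebraMap]
    refine RingHom.FiniteType.of_comp_finiteType (f := algebraMap K (𝒜 0)) ?_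
    exact (RingHom.finiteType_algebraMap (A := K) (B := MvPolynomial (Fin (n + 1)) K)).2
      inferInstance
  -- The degree-zero part of the polynomial ring is `K`, so the second factor of the structure
  -- morphism is an isomorphism.
  have hbij : Function.Bijective (algebraMap K (𝒜 0)) := by
    refine ⟨fun a b h => MvPolynomial.C_injective (Fin (n + 1)) K (congrArg Subtype.val h), ?_⟩
    rintro ⟨f, hf⟩
    refine ⟨MvPolynomial.coeff 0 f, Subtype.ext ?_⟩
    exact (MvPolynomial.totalDegree_eq_zero_iff_eq_C.1 (Nat.le_zero.1
      (MvPolynomial.IsHomogeneous.totalDegree_le hf))).symm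
  have : IsIso (CommRingCat.ofHom (algebraMap K (𝒜 0))) :=
    (ConcreteCategory.isIso_iff_bijective _).2 hbij
  have : IsProper (Proj.toSpecZero 𝒜) := inferInstance
  exact inferInstanceAs (IsProper (Proj.toSpecZero 𝒜 ≫ Spec.map (CommRingCat.ofHom
    (algebraMap K (𝒜 0)))))

lemma IsProjective.isProper {K : Type u} [Field K] {S : Scheme.{u}} [S.Over (Spec (.of K))]
    (h : IsProjective K S) : IsProper (S ↘ Spec (.of K)) := by
  obtain ⟨n, i, hi, h⟩ := h
  rw [← h]
  infer_instance

variable {K : Type u} [Field K] {S : Scheme.{u}} [IsIntegral S] [S.Over (Spec (.of K))]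

/-- On a projective integral scheme over an algebraically closed field, all regular functions are
constant. -/
lemma exists_algebraMap_eq_of_mem_H0_zero [IsAlgClosed K] (h : IsProjective K S)
    {s : S.functionField} (hs : s ∈ H0 K (0 : Divisor S)) :
    ∃ a : K, algebraMap K S.functionField a = s := by
  have := h.isProper
  obtain ⟨g, rfl⟩ := exists_germ_eq_of_forall_mem_localRing s fun x => by
    simpa using hs x 1 rfl
  -- Universal closedness makes global functions integral over `K`, and `K` is algebraically closed.
  have hint : ((S ↘ Spec (.of K)).appTop.hom.comp
      (Scheme.ΓSpecIso (.of K)).inv.hom).IsIntegral := by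
    refine RingHom.IsIntegral.trans _ _ (RingHom.isIntegral_of_surjective _ ?_)
      (isIntegral_appTop_of_universallyClosed (S ↘ Spec (.of K)))
    exact ((ConcreteCategory.isIso_iff_bijective (Scheme.ΓSpecIso (.of K)).inv).1
      inferInstance).2
  obtain ⟨a, ha⟩ := (IsAlgClosed.ringHom_bijective_of_isIntegral (k := K) _ hint).2 g
  exact ⟨a, congrArg _ ha⟩

end ConstantFunctions

/-! ### Linear equivalence and sections of opposite divisors -/

section Divisors

variable {K : Type u} [Field K] {S : Scheme.{u}} [IsIntegral S] [S.Over (Spec (.of K))]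

lemma inv_mem_H0_principalDivisor (t : (S.functionField)ˣ) :
    ((t⁻¹ : (S.functionField)ˣ) : S.functionField) ∈
      H0 K (principalDivisor S (Additive.ofMul t)) := by
  intro x f hf
  obtain ⟨a, ha⟩ := QuotientGroup.eq.1 (show QuotientGroup.mk t = QuotientGroup.mk f from hf)
  rw [← Units.val_mul, ← ha]
  exact ⟨a.1, rfl⟩

lemma mem_H0_add_principalDivisor_iff (D : Divisor S) (t : Additive (S.functionField)ˣ)
    (x : S.functionField) :
    x ∈ H0 K (D + principalDivisor S t) ↔ x * (t.toMul : S.functionField) ∈ H0 K D := by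
  constructor
  · intro hx
    have h := mul_mem_H0 K hx (inv_mem_H0_principalDivisor (t.toMul⁻¹))
    rwa [inv_inv, ofMul_inv, ofMul_toMul, map_neg, add_neg_cancel_right] at h
  · intro hx
    have h := mul_mem_H0 K hx (inv_mem_H0_principalDivisor t.toMul)
    rwa [Units.mul_inv_cancel_right, ofMul_toMul] at h

/-- If `D` and `-D` both have non-zero sections and all regular functions are constant, then `D` is
principal. -/
lemma divClass_eq_zero_of_mem_H0 [IsAlgClosed K] (h : IsProjective K S) {D : Divisor S}
    {x y : S.functionField} (hx : x ∈ H0 K D) (hy : y ∈ H0 K (-D)) (hx0 : x ≠ 0) (hy0 : y ≠ 0) :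
    divClass D = 0 := by
  have hxy := mul_mem_H0 K hx hy
  rw [add_neg_cancel] at hxy
  obtain ⟨a, ha⟩ := exists_algebraMap_eq_of_mem_H0_zero h hxy
  have ha0 : a ≠ 0 := by
    rintro rfl
    rw [map_zero] at ha
    exact mul_ne_zero hx0 hy0 ha.symm
  -- The product `x * y` is a non-zero constant, so neither section vanishes anywhere and `D` is the
  -- divisor of `x⁻¹`.
  refine (QuotientAddGroup.eq_zero_iff D).2 ⟨Additive.ofMul (Units.mk0 x hx0)⁻¹, ?_⟩
  apply Additive.toMul.injective
  refine Subtype.ext (funext fun p => ?_)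
  obtain ⟨f, hf⟩ := exists_isLocalEquation D p
  have hf' : IsLocalEquation (-D) p f⁻¹ := by
    change (localClass D p)⁻¹ = _
    rw [show localClass D p = _ from hf, QuotientGroup.mk_inv]
  refine Eq.trans ?_ hf.symm
  refine QuotientGroup.eq.2 ?_
  obtain ⟨s, hs⟩ := hx p f hf
  obtain ⟨s', hs'⟩ := hy p _ hf'
  obtain ⟨k, hk⟩ := algebraMap_mem_localRing K p a⁻¹
  -- Here `s = x * f`, `s' = y * f⁻¹` and `k = (x * y)⁻¹` in the function field, so `x * f` is a
  -- local unit.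
  have hone : s * (s' * k) = 1 := by
    apply IsFractionRing.injective (S.presheaf.stalk p) S.functionField
    rw [map_mul, map_mul, map_one, hs, hs', hk, map_inv₀, ha]
    have : (f : S.functionField) ≠ 0 := f.ne_zero
    rw [Units.val_inv_eq_inv_val]
    field_simp
  refine ⟨⟨s, s' * k, hone, by rw [mul_comm, hone]⟩, Units.ext ?_⟩
  rw [toMul_ofMul, inv_inv]
  exact hs

end Divisors

end DelPezzo

namespace DelPezzo

/-! ### Comparison of Cox rings inside the function field -/

section CoxRing

open MvPolynomial

variable {K : Type u} [Field K] {S : Scheme.{u}} [IsIntegral S] [S.Over (Spec (.of K))]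

lemma divClass_combination {r : ℕ} (D : Fin (r + 1) → Divisor S) (ν : Fin (r + 1) → ℤ) :
    divClass (combination D ν) = ∑ i, ν i • divClass (D i) := by
  simp only [combination, map_sum, map_zsmul]

/-- `Pic S` is free, so the class map splits. The splitting is the common reference for all choices
of basis. -/
lemma exists_divisor_section {r : ℕ} {D : Fin (r + 1) → Divisor S} (hD : IsPicBasis D) :
    ∃ E : Pic S →+ Divisor S, ∀ g, divClass (E g) = g := by
  let B : Module.Basis (Fin (r + 1)) ℤ (Pic S) := .mk hD.1 hD.2.ge
  refine ⟨(B.constr ℤ D).toAddMonoidHom, fun g => ?_⟩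
  have h : divClass.toIntLinearMap ∘ₗ B.constr ℤ D = LinearMap.id := B.ext fun i => by
    rw [LinearMap.comp_apply, B.constr_basis, LinearMap.id_apply, Module.Basis.mk_apply]
    rfl
  exact DFunLike.congr_fun h g

lemma exists_degree_equiv {r : ℕ} {D : Fin (r + 1) → Divisor S} (hD : IsPicBasis D) :
    ∃ N : Pic S ≃+ (Fin (r + 1) → ℤ), ∀ ν, N (divClass (combination D ν)) = ν := by
  let B : Module.Basis (Fin (r + 1)) ℤ (Pic S) := .mk hD.1 hD.2.ge
  refine ⟨B.equivFun.toAddEquiv, fun ν => ?_⟩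
  have h : divClass (combination D ν) = B.equivFun.symm ν := by
    rw [divClass_combination, B.equivFun_symm_apply]
    simp only [B, Module.Basis.mk_apply]
  rw [h]
  exact B.equivFun.apply_symm_apply ν

/-- A section of the divisor class map differs from `ν ↦ ∑ ν i • D i` by the divisors of rational
functions that can be chosen to be multiplicative in `ν`. -/
lemma exists_twist {r : ℕ} (D : Fin (r + 1) → Divisor S) {E : Pic S →+ Divisor S}
    (hE : ∀ g, divClass (E g) = g) :
    ∃ τ : (Fin (r + 1) → ℤ) →+ Additive (S.functionField)ˣ, ∀ ν,
      combination D ν = E (divClass (combination D ν)) + principalDivisor S (τ ν) := by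
  have hex (i) : ∃ t, principalDivisor S t = D i - E (divClass (D i)) :=
    (QuotientAddGroup.eq_zero_iff _).1
      (show divClass (D i - E (divClass (D i))) = 0 by rw [map_sub, hE, sub_self])
  choose t ht using hex
  -- Extending linearly from the basis makes `τ` additive, which multiplicativity of `coxEval`
  -- requires.
  refine ⟨.mk' (fun ν => ∑ i, ν i • t i) fun μ ν => ?_, fun ν => ?_⟩
  · simp only [Pi.add_apply, add_zsmul, Finset.sum_add_distrib]
  simp only [AddMonoidHom.mk'_apply, map_sum, map_zsmul, ht, divClass_combination,
    smul_sub, Finset.sum_sub_distrib, add_sub_cancel]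
  rfl

variable {r : ℕ} {D : Fin (r + 1) → Divisor S}

/-- The part of the Cox ring of given degree in `Pic S`. -/
noncomputable def coxDegree (K : Type u) [Field K] {S : Scheme.{u}} [IsIntegral S] [S.Over (Spec (.of K))]
    {r : ℕ} (D : Fin (r + 1) → Divisor S) (N : Pic S ≃+ (Fin (r + 1) → ℤ)) (g : Pic S) :
    @Submodule K (Cox K D) _ _ Algebra.toModule :=
  LinearMap.range (DirectSum.lof K (Fin (r + 1) → ℤ) (fun ν => coxPiece K D ν) (N g))

lemma mem_coxDegree_iff {N : Pic S ≃+ (Fin (r + 1) → ℤ)}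
    (hN : ∀ ν, N (divClass (combination D ν)) = ν) {s : Cox K D} {g : Pic S} :
    s ∈ coxDegree K D N g ↔ IsHomogeneousOfDegree s g := by
  constructor
  · intro h
    refine ⟨N g, N.injective ?_, h⟩
    rw [hN]
  · rintro ⟨ν, rfl, h⟩
    rw [coxDegree, hN]
    exact h

instance coxDegree_gradedMonoid (N : Pic S ≃+ (Fin (r + 1) → ℤ)) :
    SetLike.GradedMonoid (coxDegree K D N) where
  one_mem := by
    rw [coxDegree, map_zero]
    exact ⟨_, rfl⟩
  mul_mem := by
    rintro g h _ _ ⟨x, rfl⟩ ⟨y, rfl⟩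
    rw [coxDegree, map_add, DirectSum.lof_eq_of, DirectSum.lof_eq_of, DirectSum.of_mul_of]
    exact ⟨_, DirectSum.lof_eq_of K _ _ _ _⟩

lemma exists_degree_projection (N : Pic S ≃+ (Fin (r + 1) → ℤ)) (g : Pic S) :
    ∃ π : Cox K D →+ Cox K D, (∀ x ∈ coxDegree K D N g, π x = x) ∧
      ∀ h, g ≠ h → ∀ x ∈ coxDegree K D N h, π x = 0 := by
  refine ⟨(DirectSum.lof K _ _ (N g) ∘ₗ DirectSum.component K _ _ (N g)).toAddMonoidHom, ?_, ?_⟩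
  · rintro _ ⟨x, rfl⟩
    rw [LinearMap.toAddMonoidHom_coe, LinearMap.comp_apply, DirectSum.component.lof_self]
  · rintro h hgh _ ⟨x, rfl⟩
    rw [LinearMap.toAddMonoidHom_coe, LinearMap.comp_apply, DirectSum.component.of, dif_neg, map_zero]
    exact fun hN => hgh (N.injective hN).symm

/-- Forgetting the grading of the Cox ring, after multiplying the sections of degree `ν` with the
rational function `τ ν`. -/
noncomputable def coxEval (K : Type u) [Field K] {S : Scheme.{u}} [IsIntegral S]
    [S.Over (Spec (.of K))] {r : ℕ} (D : Fin (r + 1) → Divisor S)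
    (τ : (Fin (r + 1) → ℤ) →+ Additive (S.functionField)ˣ) : Cox K D →ₐ[K] S.functionField :=
  DirectSum.toAlgebra K (fun ν => coxPiece K D ν)
    (fun ν => LinearMap.mulRight K ((τ ν).toMul : S.functionField) ∘ₗ (coxPiece K D ν).subtype)
    (by
      change (1 : S.functionField) * ((τ 0).toMul : S.functionField) = 1
      rw [map_zero, toMul_zero, Units.val_one, one_mul])
    (by
      intro μ ν x y
      change (x : S.functionField) * y * ((τ (μ + ν)).toMul : S.functionField) =
        x * ((τ μ).toMul : S.functionField) * (y * ((τ ν).toMul : S.functionField))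
      rw [map_add, toMul_add, Units.val_mul]
      ring)

lemma coxEval_lof (τ : (Fin (r + 1) → ℤ) →+ Additive (S.functionField)ˣ) (ν : Fin (r + 1) → ℤ)
    (x : coxPiece K D ν) :
    coxEval K D τ (DirectSum.lof K _ (fun ν => coxPiece K D ν) ν x) =
      x * ((τ ν).toMul : S.functionField) :=
  DirectSum.toAddMonoid_of (fun ν => (LinearMap.mulRight K ((τ ν).toMul : S.functionField) ∘ₗ
    (coxPiece K D ν).subtype).toAddMonoidHom) ν x

section Twist

variable {N : Pic S ≃+ (Fin (r + 1) → ℤ)} {E : Pic S →+ Divisor S}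
  {τ : (Fin (r + 1) → ℤ) →+ Additive (S.functionField)ˣ}

/-- Sections of different degrees may coincide as rational functions, so injectivity is only claimed
within one degree. -/
lemma coxEval_injOn {g : Pic S} {x y : Cox K D} (hx : x ∈ coxDegree K D N g)
    (hy : y ∈ coxDegree K D N g) (h : coxEval K D τ x = coxEval K D τ y) : x = y := by
  obtain ⟨x, rfl⟩ := hx
  obtain ⟨y, rfl⟩ := hy
  rw [coxEval_lof, coxEval_lof] at h
  rw [Subtype.ext (mul_right_cancel₀ (Units.ne_zero _) h)]

lemma mem_coxPiece_iff (hN : ∀ ν, N (divClass (combination D ν)) = ν)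
    (hτ : ∀ ν, combination D ν = E (divClass (combination D ν)) + principalDivisor S (τ ν))
    (g : Pic S) (x : S.functionField) :
    x ∈ coxPiece K D (N g) ↔ x * ((τ (N g)).toMul : S.functionField) ∈ H0 K (E g) := by
  have hg : divClass (combination D (N g)) = g := N.injective (hN _)
  rw [coxPiece, hτ, mem_H0_add_principalDivisor_iff, hg]

lemma coxEval_mem (hN : ∀ ν, N (divClass (combination D ν)) = ν)
    (hτ : ∀ ν, combination D ν = E (divClass (combination D ν)) + principalDivisor S (τ ν))
    {g : Pic S} {s : Cox K D} (hs : s ∈ coxDegree K D N g) : coxEval K D τ s ∈ H0 K (E g) := by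
  obtain ⟨x, rfl⟩ := hs
  rw [coxEval_lof, ← mem_coxPiece_iff hN hτ]
  exact x.2

lemma exists_coxEval_eq (hN : ∀ ν, N (divClass (combination D ν)) = ν)
    (hτ : ∀ ν, combination D ν = E (divClass (combination D ν)) + principalDivisor S (τ ν))
    {g : Pic S} {v : S.functionField} (hv : v ∈ H0 K (E g)) :
    ∃ s ∈ coxDegree K D N g, coxEval K D τ s = v := by
  have hv' : v * (((τ (N g)).toMul⁻¹ : (S.functionField)ˣ) : S.functionField) ∈
      coxPiece K D (N g) := by
    rwa [mem_coxPiece_iff hN hτ, Units.inv_mul_cancel_right]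
  refine ⟨_, ⟨⟨_, hv'⟩, rfl⟩, ?_⟩
  rw [coxEval_lof, Units.inv_mul_cancel_right]

variable {t : ℕ} {e : Fin t → Cox K D} {c : Fin t → Pic S}

lemma coxEval_aeval (f : MvPolynomial (Fin t) K) :
    coxEval K D τ (aeval e f) = aeval (fun i => coxEval K D τ (e i)) f :=
  comp_aeval_apply e (coxEval K D τ) f

lemma aeval_mem_coxDegree (hec : ∀ i, e i ∈ coxDegree K D N (c i)) {f : MvPolynomial (Fin t) K}
    {g : Pic S} (hf : IsWeightedHomogeneous c f g) : aeval e f ∈ coxDegree K D N g :=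
  aeval_mem_graded (coxDegree K D N) hec hf

lemma aeval_component_eq (hec : ∀ i, e i ∈ coxDegree K D N (c i)) {f : MvPolynomial (Fin t) K}
    {g : Pic S} (hf : aeval e f ∈ coxDegree K D N g) :
    aeval e (weightedHomogeneousComponent c g f) = aeval e f := by
  obtain ⟨π, hπ, hπ'⟩ := exists_degree_projection (K := K) (D := D) N g
  exact (projection_aeval (coxDegree K D N) hec hπ hπ' f).symm.trans (hπ _ hf)

lemma IsMinimalGenerators.isMinimalSectionSystem (he : IsMinimalGenerators e c)
    (hN : ∀ ν, N (divClass (combination D ν)) = ν)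
    (hτ : ∀ ν, combination D ν = E (divClass (combination D ν)) + principalDivisor S (τ ν)) :
    IsMinimalSectionSystem (fun g => H0 K (E g)) (fun i => coxEval K D τ (e i)) c := by
  have hec (i) : e i ∈ coxDegree K D N (c i) := (mem_coxDegree_iff hN).2 (he.homogeneous i)
  refine ⟨fun i => coxEval_mem hN hτ (hec i), fun {g} v hv => ?_, fun i f hf hi h => ?_⟩
  · obtain ⟨s, hs, rfl⟩ := exists_coxEval_eq hN hτ hv
    obtain ⟨f, rfl⟩ : s ∈ (aeval e : MvPolynomial (Fin t) K →ₐ[K] Cox K D).range := by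
      rw [← Algebra.adjoin_range_eq_range_aeval, he.generate]
      trivial
    refine ⟨weightedHomogeneousComponent c g f,
      weightedHomogeneousComponent_isWeightedHomogeneous _ _, ?_⟩
    rw [← coxEval_aeval]
    exact congrArg _ (aeval_component_eq hec hs)
  · rw [← coxEval_aeval] at h
    -- Both sides have degree `c i`, so the equality lifts to the Cox ring and makes `e i` redundant
    -- there.
    have hei := coxEval_injOn (aeval_mem_coxDegree hec hf) (hec i) h
    refine he.minimal {i}ᶜ (fun h => ?_) ?_
    · exact (h ▸ Set.mem_univ i : i ∈ ({i}ᶜ : Set (Fin t))) rfl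
    rw [eq_top_iff, ← he.generate, Algebra.adjoin_le_iff]
    rintro _ ⟨k, rfl⟩
    by_cases hk : k = i
    · subst hk
      have hf' : f ∈ Algebra.adjoin K ((X : Fin t → MvPolynomial (Fin t) K) '' {k}ᶜ) := by
        change f ∈ supported K {k}ᶜ
        rw [mem_supported]
        intro l hl hlk
        exact hi (hlk ▸ hl)
      have hmap : aeval e f ∈ (Algebra.adjoin K
          ((X : Fin t → MvPolynomial (Fin t) K) '' {k}ᶜ)).map (aeval e) := ⟨f, hf', rfl⟩
      rw [AlgHom.map_adjoin, Set.image_image] at hmap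
      have himage : (fun l => aeval e (X l : MvPolynomial (Fin t) K)) '' {k}ᶜ = e '' {k}ᶜ :=
        Set.image_congr fun l _ => aeval_X e l
      rw [himage] at hmap
      exact hei ▸ hmap
    · exact Algebra.subset_adjoin ⟨k, hk, rfl⟩

lemma IsMinimalRelations.isMinimalRelationSystem {m : ℕ} {R : Fin m → MvPolynomial (Fin t) K}
    {b : Fin m → Pic S} (hR : IsMinimalRelations e c R b) (he : IsMinimalGenerators e c)
    (hN : ∀ ν, N (divClass (combination D ν)) = ν) :
    IsMinimalRelationSystem (fun i => coxEval K D τ (e i)) c R b := by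
  have hec (i) : e i ∈ coxDegree K D N (c i) := (mem_coxDegree_iff hN).2 (he.homogeneous i)
  refine ⟨hR.homogeneous, fun {f g} hf => ?_, fun j hj => ?_⟩
  · rw [hR.generate, RingHom.mem_ker, ← coxEval_aeval]
    refine ⟨fun h => ?_, fun h => ?_⟩
    · have h' : aeval e f = 0 := h
      rw [h', map_zero]
    · exact coxEval_injOn (aeval_mem_coxDegree hec hf) (zero_mem _)
        (h.trans (map_zero _).symm)
  · refine hR.minimal {j}ᶜ (fun h => ?_) ?_
    · exact (h ▸ Set.mem_univ j : j ∈ ({j}ᶜ : Set (Fin m))) rfl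
    rw [← hR.generate]
    refine le_antisymm (Ideal.span_mono (Set.image_subset_range _ _)) (Ideal.span_le.2 ?_)
    rintro _ ⟨k, rfl⟩
    by_cases hk : k = j
    · exact hk ▸ hj
    · exact Ideal.subset_span ⟨k, hk, rfl⟩

end Twist

lemma isPointedSystem_H0 [IsAlgClosed K] (h : IsProjective K S) {E : Pic S →+ Divisor S}
    (hE : ∀ g, divClass (E g) = g) : IsPointedSystem fun g => H0 K (E g) where
  one_mem := by
    rw [map_zero]
    exact one_mem_H0 K
  mul_mem g g' x y hx hy := by
    rw [map_add]
    exact mul_mem_H0 K hx hy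
  exists_constant x hx := by
    rw [map_zero] at hx
    exact exists_algebraMap_eq_of_mem_H0_zero h hx
  pointed {g x y} hx hy hx0 hy0 := by
    rw [map_neg] at hy
    rw [← hE g]
    exact divClass_eq_zero_of_mem_H0 h hx hy hx0 hy0

end CoxRing

end DelPezzo

theorem lemma2p2 (K : Type u) [Field K] [IsAlgClosed K] [CharZero K]
    (S : Scheme.{u}) [IsIntegral S] [S.Over (Spec (.of K))]
    (hS : DelPezzo.IsGeneralizedDelPezzo K S)
    {r r' : ℕ} (D : Fin (r + 1) → DelPezzo.Divisor S) (D' : Fin (r' + 1) → DelPezzo.Divisor S)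
    (hD : DelPezzo.IsPicBasis D) (hD' : DelPezzo.IsPicBasis D')
    {t t' : ℕ}
    (e : Fin t → DelPezzo.Cox K D) (c : Fin t → DelPezzo.Pic S)
    (he : DelPezzo.IsMinimalGenerators e c)
    (e' : Fin t' → DelPezzo.Cox K D') (c' : Fin t' → DelPezzo.Pic S)
    (he' : DelPezzo.IsMinimalGenerators e' c') :
    (t = t' ∧ Finset.univ.val.map c = Finset.univ.val.map c') ∧
      ∀ {m m' : ℕ}
        (R : Fin m → MvPolynomial (Fin t) K) (b : Fin m → DelPezzo.Pic S)
        (R' : Fin m' → MvPolynomial (Fin t') K) (b' : Fin m' → DelPezzo.Pic S),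
        DelPezzo.IsMinimalRelations e c R b → DelPezzo.IsMinimalRelations e' c' R' b' →
          m = m' ∧ Finset.univ.val.map b = Finset.univ.val.map b' := by
  obtain ⟨E, hE⟩ := DelPezzo.exists_divisor_section hD
  obtain ⟨N, hN⟩ := DelPezzo.exists_degree_equiv hD
  obtain ⟨N', hN'⟩ := DelPezzo.exists_degree_equiv hD'
  obtain ⟨τ, hτ⟩ := DelPezzo.exists_twist D hE
  -- The same `E`, although built from `D`, serves for `D'`: both systems become sections of the
  -- spaces `H0 K (E g)`.
  obtain ⟨τ', hτ'⟩ := DelPezzo.exists_twist D' hE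
  have hV := DelPezzo.isPointedSystem_H0 hS.projective hE
  have hs := he.isMinimalSectionSystem hN hτ
  have hs' := he'.isMinimalSectionSystem hN' hτ'
  have hcard {n n' : ℕ} {b : Fin n → DelPezzo.Pic S} {b' : Fin n' → DelPezzo.Pic S}
      (h : Finset.univ.val.map b = Finset.univ.val.map b') : n = n' := by
    simpa using congrArg Multiset.card h
  have hc := DelPezzo.map_univ_eq_of_card_eq fun d =>
    le_antisymm (hs.card_degree_le hV hs' d) (hs'.card_degree_le hV hs d)
  refine ⟨⟨hcard hc, hc⟩, fun R b R' b' hR hR' => ?_⟩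
  have hr := hR.isMinimalRelationSystem (τ := τ) he hN
  have hr' := hR'.isMinimalRelationSystem (τ := τ') he' hN'
  have hb := DelPezzo.map_univ_eq_of_card_eq fun d =>
    le_antisymm (hs.card_relation_degree_le hV hs' hr hr' d)
      (hs'.card_relation_degree_le hV hs hr' hr d)
  exact ⟨hcard hb, hb⟩
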